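/- A hypergraph $H=(V,E)$ consists of a finite set $V$ of vertices and a set $E$ of hyperedges, each hyperedge being a subset of $V$ with at least two elements; its order is $|V|$. A path of length $r$ from $u$ to $v$ is a sequence $(v_0,e_1,v_1,\ldots,e_r,v_r)$ with $v_0=u$, $v_r=v$, in which each $e_i$ is a hyperedge containing $v_{i-1}$ and $v_i$, and no vertex and no hyperedge appears more than once. The distance $d(u,v)$ is the length of a shortest path from $u$ to $v$ ($\infty$ if there is none), and $W(H)=\sum_{\{u,v\}\subseteq V,\,u\ne v} d(u,v)$. The hypergraph $H$ is connected if $V\neq\emptyset$ and any two vertices are joined by a path. For $v\in V$, $H\setminus v$ is the hypergraph with vertex set $V\setminus\{v\}$ whose hyperedges are the hyperedges of $H$ not containing $v$. A Šoltés hypergraph is a connected hypergraph $H$ of order different from $1$ such that $W(H)$ is finite and $W(H\setminus v)=W(H)$ for every vertex $v$ of $H$. **Theorem.** Every Šoltés hypergraph has order at least $5$. Up to isomorphism there is exactly one Šoltés hypergraph of order $5$, namely the $5$-cycle $C_5$ (with its edges as hyperedges of size two) together with one hyperedge containing all $5$ vertices. For every $n\ge 5$ there exists a Šoltés hypergraph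 of order $n$. -/

import Mathlib

namespace Hypergraph

/-- `H.IsPath r x e` says that `(x 0, e 0, x 1, e 1, …, e (r - 1), x r)` is a path of length `r` in
`H`: every hyperedge `e i` contains both `x i` and `x (i + 1)`, and no vertex and no hyperedge
appears more than once. -/
structure IsPath {α : Type*} (H : Hypergraph α) (r : ℕ)
    (x : Fin (r + 1) → α) (e : Fin r → Set α) : Prop where
  vertex_mem : ∀ i, x i ∈ H.vertexSet
  edge_mem : ∀ i, e i ∈ H.edgeSet
  left_mem : ∀ i : Fin r, x i.castSucc ∈ e i
  right_mem : ∀ i : Fin r, x i.succ ∈ e i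
  vertex_injective : Function.Injective x
  edge_injective : Function.Injective e

/-- There is a path of length `r` from `u` to `v` in `H`. -/
def HasPath {α : Type*} (H : Hypergraph α) (u v : α) (r : ℕ) : Prop :=
  ∃ (x : Fin (r + 1) → α) (e : Fin r → Set α),
    H.IsPath r x e ∧ x 0 = u ∧ x (Fin.last r) = v

/-- The distance between `u` and `v`: the length of a shortest path, and `⊤` if there is none. -/
noncomputable def pathDist {α : Type*} (H : Hypergraph α) (u v : α) : ℕ∞ :=
  ⨅ r ∈ {r : ℕ | H.HasPath u v r}, (r : ℕ∞)

theorem HasPath.symm {α : Type*} {H : Hypergraph α} {u v : α} {r : ℕ}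
    (h : H.HasPath u v r) : H.HasPath v u r := by
  obtain ⟨x, e, h, h0, h1⟩ := h
  refine ⟨fun i => x i.rev, fun i => e i.rev, ⟨fun i => h.vertex_mem _, fun i => h.edge_mem _,
    fun i => ?_, fun i => ?_, h.vertex_injective.comp Fin.rev_injective,
    h.edge_injective.comp Fin.rev_injective⟩, ?_, ?_⟩
  · simpa [Fin.rev_castSucc] using h.right_mem i.rev
  · simpa [Fin.rev_succ] using h.left_mem i.rev
  · simpa using h1
  · simpa using h0

theorem pathDist_comm {α : Type*} (H : Hypergraph α) (u v : α) :
    H.pathDist u v = H.pathDist v u := by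
  have h : {r : ℕ | H.HasPath u v r} = {r : ℕ | H.HasPath v u r} :=
    Set.ext fun _ => ⟨HasPath.symm, HasPath.symm⟩
  unfold pathDist
  rw [h]

/-- The Wiener index (total distance) of a hypergraph with finitely many vertices: the sum of the
distances over all unordered pairs of distinct vertices. It is `⊤` as soon as two vertices are not
joined by a path. -/
noncomputable def wiener {α : Type*} (H : Hypergraph α) : ℕ∞ :=
  ∑ᶠ p ∈ {p : Sym2 α | ¬ p.IsDiag ∧ ∀ x ∈ p, x ∈ H.vertexSet},
    Sym2.lift ⟨H.pathDist, H.pathDist_comm⟩ p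

/-- The hypergraph `H ∖ v`: remove the vertex `v` and all hyperedges containing `v`. -/
def deleteVertex {α : Type*} (H : Hypergraph α) (v : α) : Hypergraph α where
  vertexSet := H.vertexSet \ {v}
  edgeSet := {e ∈ H.edgeSet | v ∉ e}
  subset_vertexSet_of_mem_edgeSet' := fun _ he _ hx =>
    ⟨H.subset_vertexSet_of_mem_edgeSet' he.1 hx, fun hxv => he.2 (hxv ▸ hx)⟩

/-- A hypergraph is connected if it has a vertex and any two vertices are joined by a path. -/
def IsConnected {α : Type*} (H : Hypergraph α) : Prop :=
  H.vertexSet.Nonempty ∧ ∀ u ∈ H.vertexSet, ∀ v ∈ H.vertexSet, ∃ r, H.HasPath u v r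

/-- Šoltés hypergraphs: finite connected hypergraphs, all of whose hyperedges have at least two
vertices, other than the one-vertex hypergraph, such that the Wiener index is finite and does not
change when any one vertex is removed. -/
structure IsSoltes {α : Type*} (H : Hypergraph α) : Prop where
  finite : H.vertexSet.Finite
  edge_nontrivial : ∀ e ∈ H.edgeSet, e.Nontrivial
  connected : H.IsConnected
  order_ne_one : H.vertexSet.ncard ≠ 1
  wiener_ne_top : H.wiener ≠ ⊤
  wiener_deleteVertex : ∀ v ∈ H.vertexSet, (H.deleteVertex v).wiener = H.wiener

/-- Isomorphism of hypergraphs: a bijection between the vertex sets under which a set of vertices is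
a hyperedge if and only if its image is one. -/
def IsIsomorphic {α β : Type*} (H : Hypergraph α) (K : Hypergraph β) : Prop :=
  ∃ f : H.vertexSet ≃ K.vertexSet, ∀ s : Set H.vertexSet,
    Subtype.val '' s ∈ H.edgeSet ↔ Subtype.val '' (f '' s) ∈ K.edgeSet

/-- The cycle `C₅` on the vertices `0, …, 4`, together with the hyperedge of all `5` vertices. -/
def fiveCyclePlus : Hypergraph (ZMod 5) where
  vertexSet := Set.univ
  edgeSet := {e | (∃ i : ZMod 5, e = {i, i + 1}) ∨ e = Set.univ}
  subset_vertexSet_of_mem_edgeSet' := fun _ _ => Set.subset_univ _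

end Hypergraph

namespace Hypergraph

/-! Distances in a hypergraph are distances in its two-section (`pathDist_eq_edist`), and everything
is counted over ordered pairs, so that `2 * wiener` is a plain double sum.

Lower bound on the order. With n vertices, 2W(H) ≥ n(n-1), since distinct vertices are at distance
at least 1. A connected two-section on n-1 vertices has largest total distance when it is a path.
For n ≤ 4 even this maximum is below n(n-1). For n = 5 both bounds equal 20, so all distances in H
are 1 and every H∖v is an induced path on four vertices (`exists_induced_path`), with exactly three
hyperedges, all of them pairs (`IsSoltes.exists_path`). Comparing the five deletions forces the
5-cycle together with the full hyperedge.

Existence. Let the whole vertex set be a hyperedge. Then 2W(H) = n(n-1), while any deletion destroys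
that hyperedge. As n(n-1) = (n-1)(n-2) + 2(n-1), each H∖v must have total excess over distance 1
equal to 2(n-1), in ordered pairs (`isSoltes_of_adj`). For n ≥ 8 this is arranged on ℤ/n.
Consecutive elements share no hyperedge but the full one, which gives n-2 nonadjacent pairs avoiding
v. Elements differing by 2 share only a translate of {0, 3, 5}, so deleting v separates just one
more pair, {v+3, v+5}. Common neighbours keep all distances at most 2, so the excess is n-1
unordered pairs. Orders 5, 6 and 7 have separate examples. -/

/-- The graph in which two distinct vertices are adjacent if they lie in a common hyperedge. -/
def twoSection {α : Type*} (H : Hypergraph α) : SimpleGraph α where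
  Adj u v := u ≠ v ∧ ∃ e ∈ H.edgeSet, u ∈ e ∧ v ∈ e
  symm := ⟨fun _ _ ⟨h, e, he, hu, hv⟩ => ⟨h.symm, e, he, hv, hu⟩⟩
  loopless := ⟨fun _ h => h.1 rfl⟩

/-! ### Hypergraph distance as distance in the two-section -/

section Distance

variable {α : Type*} {H : Hypergraph α} {u v : α}

theorem mem_vertexSet_of_walk {u v : α} (p : H.twoSection.Walk u v) (hu : u ∈ H.vertexSet) :
    v ∈ H.vertexSet := by
  induction p with
  | nil => exact hu
  | cons h _ ih =>
    obtain ⟨-, e, he, -, hv⟩ := h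
    exact ih (H.subset_vertexSet_of_mem_edgeSet' he hv)

theorem edist_le_one_of_mem_edge {e : Set α} (he : e ∈ H.edgeSet) (hu : u ∈ e) (hv : v ∈ e) :
    H.twoSection.edist u v ≤ 1 := by
  rw [SimpleGraph.edist_le_one_iff_adj_or_eq]
  by_cases h : u = v
  · exact Or.inr h
  · exact Or.inl ⟨h, e, he, hu, hv⟩

theorem HasPath.edist_le {r : ℕ} (h : H.HasPath u v r) : H.twoSection.edist u v ≤ r := by
  obtain ⟨x, e, h, rfl, rfl⟩ := h
  have key : ∀ i : ℕ, ∀ hi : i < r + 1, H.twoSection.edist (x 0) (x ⟨i, hi⟩) ≤ i := by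
    intro i
    induction i with
    | zero => intro hi; simp
    | succ i ih =>
      intro hi
      have h1 := edist_le_one_of_mem_edge (h.edge_mem ⟨i, by omega⟩)
        (h.left_mem ⟨i, by omega⟩) (h.right_mem ⟨i, by omega⟩)
      refine SimpleGraph.edist_triangle.trans ((add_le_add (ih (by omega)) h1).trans ?_)
      push_cast
      exact le_rfl
  exact key r (by omega)

/-- A geodesic of the two-section never needs the same hyperedge twice: if steps i < j used one
hyperedge, the start of step i and the end of step j would be at distance at most 1, giving a
shortcut. Hence the distinctness of hyperedges demanded of a path costs nothing. -/
theorem exists_hasPath_of_reachable (hu : u ∈ H.vertexSet) (h : H.twoSection.Reachable u v) :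
    ∃ r : ℕ, H.HasPath u v r ∧ H.twoSection.edist u v = r := by
  obtain ⟨p, hp⟩ := h.exists_walk_length_eq_dist
  have hk : H.twoSection.edist u v = p.length := by rw [hp, h.coe_dist_eq_edist]
  have hpath := p.isPath_of_length_eq_dist hp
  have hadj : ∀ i : Fin p.length, H.twoSection.Adj (p.getVert i) (p.getVert (i + 1)) :=
    fun i => p.adj_getVert_succ i.2
  choose _ e he hl hr using hadj
  refine ⟨p.length, ⟨fun i => p.getVert i, e, ⟨fun i => ?_, he, hl, hr, fun i j hij => ?_, ?_⟩,
    by simp, by simp⟩, hk⟩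
  · exact mem_vertexSet_of_walk (p.take i) hu
  · exact Fin.ext (hpath.getVert_injOn (by simpa using Nat.lt_succ_iff.mp i.2)
      (by simpa using Nat.lt_succ_iff.mp j.2) hij)
  · have key : ∀ i j : Fin p.length, i < j → e i ≠ e j := by
      intro i j hij heq
      have h1 := edist_le_one_of_mem_edge (he i) (hl i) (heq ▸ hr j)
      have h2 := SimpleGraph.edist_le (p.take i)
      have h3 := SimpleGraph.edist_le (p.drop (j + 1))
      have h4 : H.twoSection.edist u v ≤ _ :=
        (SimpleGraph.edist_triangle (v := p.getVert i)).trans (add_le_add le_rfl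
          (SimpleGraph.edist_triangle (v := p.getVert (j + 1))))
      have h5 := h4.trans (add_le_add h2 (add_le_add h1 h3))
      rw [hk, SimpleGraph.Walk.take_length, SimpleGraph.Walk.drop_length] at h5
      norm_cast at h5
      have := j.2
      have := Fin.lt_def.mp hij
      omega
    intro i j hij
    by_contra hne
    rcases lt_or_gt_of_ne hne with h | h
    · exact key _ _ h hij
    · exact key _ _ h hij.symm

/-- Membership of `u` matters: outside the vertex set there is no path of length 0, while `edist u u
= 0`. -/
theorem pathDist_eq_edist (hu : u ∈ H.vertexSet) :
    H.pathDist u v = H.twoSection.edist u v := by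
  apply le_antisymm
  · by_cases h : H.twoSection.Reachable u v
    · obtain ⟨r, hr, hd⟩ := exists_hasPath_of_reachable hu h
      rw [hd]
      exact iInf₂_le r hr
    · rw [SimpleGraph.edist_eq_top_of_not_reachable h]
      exact le_top
  · exact le_iInf₂ fun r hr => HasPath.edist_le hr

end Distance

/-! ### The Wiener index as a sum over ordered pairs -/

section Wiener

variable {α : Type*} {H : Hypergraph α} [DecidableEq α] {s : Finset α}

theorem wiener_eq_sum (hs : (s : Set α) = H.vertexSet) :
    H.wiener = ∑ p ∈ s.offDiag.image (fun p => s(p.1, p.2)),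
      Sym2.lift ⟨H.pathDist, H.pathDist_comm⟩ p := by
  unfold wiener
  rw [← finsum_mem_coe_finset]
  refine finsum_mem_congr ?_ fun _ _ => rfl
  ext p
  induction p with
  | _ x y =>
    rw [← hs]
    simp only [Sym2.mk_isDiag_iff, Sym2.mem_iff, Finset.mem_coe, Set.mem_ofPred_eq,
      Finset.coe_image, Set.mem_image, Finset.mem_offDiag, Prod.exists, Sym2.eq_iff]
    constructor
    · rintro ⟨h, h2⟩
      exact ⟨x, y, ⟨h2 x (Or.inl rfl), h2 y (Or.inr rfl), h⟩, Or.inl ⟨rfl, rfl⟩⟩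
    · grind

/-- Twice the Wiener index is the sum of the distances over all ordered pairs. -/
theorem two_mul_wiener (hs : (s : Set α) = H.vertexSet) :
    2 * H.wiener = ∑ p ∈ s.offDiag, H.twoSection.edist p.1 p.2 := by
  classical
  rw [wiener_eq_sum hs, Finset.mul_sum, ← Finset.sum_fiberwise_of_maps_to
    (g := fun p : α × α => s(p.1, p.2)) (t := s.offDiag.image (fun p => s(p.1, p.2)))
    (fun p hp => Finset.mem_image_of_mem _ hp)]
  refine Finset.sum_congr rfl fun q hq => ?_
  obtain ⟨⟨x, y⟩, hp, rfl⟩ := Finset.mem_image.mp hq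
  obtain ⟨hx, hy, hxy⟩ := Finset.mem_offDiag.mp hp
  have hfib : s.offDiag.filter (fun p => s(p.1, p.2) = s(x, y)) = {(x, y), (y, x)} := by
    ext ⟨a, b⟩
    simp only [Finset.mem_filter, Finset.mem_offDiag, Finset.mem_insert, Finset.mem_singleton,
      Prod.mk.injEq, Sym2.eq_iff]
    grind
  have hx' : x ∈ H.vertexSet := hs ▸ hx
  rw [hfib, Finset.sum_pair (by simp [hxy])]
  simp only [Sym2.lift_mk, pathDist_eq_edist hx', H.twoSection.edist_comm (u := y) (v := x)]
  rw [two_mul]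

theorem card_offDiag_le_two_mul_wiener (hs : (s : Set α) = H.vertexSet) :
    (s.offDiag.card : ℕ∞) ≤ 2 * H.wiener := by
  rw [two_mul_wiener hs, Finset.card_eq_sum_ones, Nat.cast_sum]
  refine Finset.sum_le_sum fun p hp => ?_
  have := SimpleGraph.edist_pos_of_ne (G := H.twoSection) (Finset.mem_offDiag.mp hp).2.2
  simpa using Order.one_le_iff_pos.mpr this

theorem edist_ne_top_of_wiener_ne_top (hs : (s : Set α) = H.vertexSet) (h : H.wiener ≠ ⊤)
    {x y : α} (hx : x ∈ s) (hy : y ∈ s) : H.twoSection.edist x y ≠ ⊤ := by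
  by_cases hxy : x = y
  · subst hxy; simp
  · intro htop
    have h2 : 2 * H.wiener ≠ ⊤ := by simpa [two_mul] using h
    rw [two_mul_wiener hs] at h2
    apply h2
    rw [eq_top_iff, ← htop]
    exact Finset.single_le_sum (f := fun p : α × α => H.twoSection.edist p.1 p.2)
      (fun _ _ => zero_le) (Finset.mem_offDiag.mpr ⟨hx, hy, hxy⟩ : (x, y) ∈ _)

/-- A geodesic visits distinct vertices, all of them in `s`, and has one more vertex than its
length. -/
theorem edist_lt_card (hs : (s : Set α) = H.vertexSet) {x y : α} (hx : x ∈ s)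
    (h : H.twoSection.edist x y ≠ ⊤) : H.twoSection.edist x y < s.card := by
  have hr := SimpleGraph.reachable_of_edist_ne_top h
  obtain ⟨p, hp⟩ := hr.exists_walk_length_eq_dist
  have hpath := p.isPath_of_length_eq_dist hp
  rw [← hr.coe_dist_eq_edist, ← hp]
  have hx' : x ∈ H.vertexSet := hs ▸ hx
  have hsub : p.support.toFinset ⊆ s := by
    intro z hz
    rw [List.mem_toFinset] at hz
    have := mem_vertexSet_of_walk (p.takeUntil z hz) hx'
    rwa [← hs] at this
  have := Finset.card_le_card hsub
  rw [List.toFinset_card_of_nodup hpath.support_nodup, SimpleGraph.Walk.length_support] at this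
  exact_mod_cast this

end Wiener

/-! ### Four vertices: total distance 20 characterises the induced path -/

section Four

variable {α : Type*} {H : Hypergraph α} [DecidableEq α] {s : Finset α}

theorem two_mul_wiener_of_four {a b c d : α} (hs : ({a, b, c, d} : Set α) = H.vertexSet)
    (hab : a ≠ b) (hac : a ≠ c) (had : a ≠ d) (hbc : b ≠ c) (hbd : b ≠ d) (hcd : c ≠ d) :
    2 * H.wiener = 2 * (H.twoSection.edist a b + H.twoSection.edist a c + H.twoSection.edist a d
      + H.twoSection.edist b c + H.twoSection.edist b d + H.twoSection.edist c d) := by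
  have hs' : (({a, b, c, d} : Finset α) : Set α) = H.vertexSet := by simpa using hs
  rw [two_mul_wiener hs', Finset.sum_subset (s₂ := {a, b, c, d} ×ˢ {a, b, c, d})]
  · rw [Finset.sum_product]
    simp only [Finset.sum_insert, Finset.mem_insert, Finset.mem_singleton, Finset.sum_singleton,
      hab, hac, had, hbc, hbd, hcd, or_self, not_false_eq_true, SimpleGraph.edist_self]
    rw [H.twoSection.edist_comm (u := b) (v := a), H.twoSection.edist_comm (u := c) (v := a),
      H.twoSection.edist_comm (u := d) (v := a), H.twoSection.edist_comm (u := c) (v := b),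
      H.twoSection.edist_comm (u := d) (v := b), H.twoSection.edist_comm (u := d) (v := c)]
    ring
  · intro p hp
    rw [Finset.mem_offDiag] at hp
    exact Finset.mem_product.mpr ⟨hp.1, hp.2.1⟩
  · intro p hp hp'
    rw [Finset.mem_product] at hp
    have : p.1 = p.2 := by
      by_contra hne
      exact hp' (Finset.mem_offDiag.mpr ⟨hp.1, hp.2, hne⟩)
    rw [this, SimpleGraph.edist_self]

theorem two_mul_wiener_of_path {a b c d : α} (hs : ({a, b, c, d} : Set α) = H.vertexSet)
    (hac : a ≠ c) (had : a ≠ d) (hbd : b ≠ d)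
    (hab : H.twoSection.Adj a b) (hbc : H.twoSection.Adj b c) (hcd : H.twoSection.Adj c d)
    (nac : ¬ H.twoSection.Adj a c) (nad : ¬ H.twoSection.Adj a d)
    (nbd : ¬ H.twoSection.Adj b d) : 2 * H.wiener = 20 := by
  have h1 := SimpleGraph.edist_eq_one_iff_adj.mpr hab
  have h2 := SimpleGraph.edist_eq_one_iff_adj.mpr hbc
  have h3 := SimpleGraph.edist_eq_one_iff_adj.mpr hcd
  have h4 : H.twoSection.edist a c = 2 :=
    SimpleGraph.edist_eq_two_iff.mpr ⟨hac, nac, b,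
      by simp [SimpleGraph.mem_commonNeighbors, hab, hbc.symm]⟩
  have h5 : H.twoSection.edist b d = 2 :=
    SimpleGraph.edist_eq_two_iff.mpr ⟨hbd, nbd, c,
      by simp [SimpleGraph.mem_commonNeighbors, hbc, hcd.symm]⟩
  have h6 : H.twoSection.edist a d = 3 := by
    apply le_antisymm
    · refine (SimpleGraph.edist_triangle (v := c)).trans ?_
      rw [h4, h3]; norm_num
    · have : (2 : ℕ∞) < H.twoSection.edist a d := by
        rw [SimpleGraph.two_lt_edist_iff]
        refine ⟨had, nad, ?_⟩
        ext w
        simp only [SimpleGraph.mem_commonNeighbors, Set.mem_empty_iff_false, iff_false, not_and]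
        intro haw hdw
        obtain ⟨-, e, he, -, hwe⟩ := id haw
        have hw := H.subset_vertexSet_of_mem_edgeSet' he hwe
        rw [← hs] at hw
        rcases hw with rfl | rfl | rfl | rfl
        · exact nad hdw.symm
        · exact nbd hdw.symm
        · exact nac haw
        · exact nad haw
      have h := Order.add_one_le_of_lt this
      norm_num at h
      exact h
  rw [two_mul_wiener_of_four hs hab.ne hac had hbc.ne hbd hcd.ne, h1, h2, h3, h4, h5, h6]
  norm_num

/-- A geodesic of length 3 is an induced path through all four vertices. Without one, all distances
are at most 2, and connectedness makes the total too small. -/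
theorem exists_induced_path {s : Finset α} (hs : (s : Set α) = H.vertexSet) (hcard : s.card = 4)
    (hfin : H.wiener ≠ ⊤) (hW : 20 ≤ 2 * H.wiener) :
    ∃ a b c d : α, s = {a, b, c, d} ∧ a ≠ c ∧ a ≠ d ∧ b ≠ d ∧
      H.twoSection.Adj a b ∧ H.twoSection.Adj b c ∧ H.twoSection.Adj c d ∧
      ¬ H.twoSection.Adj a c ∧ ¬ H.twoSection.Adj a d ∧ ¬ H.twoSection.Adj b d := by
  by_cases hfar : ∃ x ∈ s, ∃ y ∈ s, 2 < H.twoSection.edist x y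
  · obtain ⟨x, hx, y, hy, hxy⟩ := hfar
    have htop := edist_ne_top_of_wiener_ne_top hs hfin hx hy
    have hlt := edist_lt_card hs hx htop
    obtain ⟨k, hk⟩ := ENat.ne_top_iff_exists.mp htop
    rw [hcard] at hlt
    rw [← hk] at hxy hlt
    have hk3 : k = 3 := by
      have h1 : 2 < k := by exact_mod_cast hxy
      have h2 : k < 4 := by exact_mod_cast hlt
      omega
    subst hk3
    obtain ⟨p, hp⟩ := SimpleGraph.exists_walk_of_edist_eq_coe hk.symm
    have hadj : ∀ i < 3, H.twoSection.Adj (p.getVert i) (p.getVert (i + 1)) :=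
      fun i hi => p.adj_getVert_succ (hp ▸ hi)
    have hx0 : p.getVert 0 = x := by simp
    have hy3 : p.getVert 3 = y := by rw [← hp]; simp
    have hab := hx0 ▸ hadj 0 (by norm_num)
    have hbc := hadj 1 (by norm_num)
    have hcd := hy3 ▸ hadj 2 (by norm_num)
    -- Negating `edist ≤ 1` excludes adjacency and equality at once; either would shorten the
    -- geodesic from `x` to `y`.
    have hac : ¬ H.twoSection.edist x (p.getVert 2) ≤ 1 := by
      intro h
      have h2 := SimpleGraph.edist_triangle.trans
        (add_le_add h (SimpleGraph.edist_eq_one_iff_adj.mpr hcd).le)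
      rw [← hk] at h2
      norm_num at h2
    have hbd : ¬ H.twoSection.edist (p.getVert 1) y ≤ 1 := by
      intro h
      have h2 := SimpleGraph.edist_triangle.trans
        (add_le_add (SimpleGraph.edist_eq_one_iff_adj.mpr hab).le h)
      rw [← hk] at h2
      norm_num at h2
    have had : ¬ H.twoSection.edist x y ≤ 1 := by
      rw [← hk]; norm_num
    rw [SimpleGraph.edist_le_one_iff_adj_or_eq, not_or] at hac hbd had
    refine ⟨x, p.getVert 1, p.getVert 2, y, ?_, hac.2, had.2, hbd.2, hab, hbc, hcd,
      hac.1, had.1, hbd.1⟩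
    symm
    have hmem : ∀ i, p.getVert i ∈ s := fun i => by
      have := mem_vertexSet_of_walk (p.take i) (hs ▸ hx)
      rwa [← hs] at this
    apply Finset.eq_of_subset_of_card_le
    · intro z hz
      simp only [Finset.mem_insert, Finset.mem_singleton] at hz
      rcases hz with rfl | rfl | rfl | rfl
      exacts [hx, hmem 1, hmem 2, hy]
    · rw [hcard, Finset.card_insert_of_notMem, Finset.card_insert_of_notMem,
        Finset.card_insert_of_notMem, Finset.card_singleton]
      · simpa using hcd.ne
      · simpa using ⟨hbc.ne, hbd.2⟩
      · simpa using ⟨hab.ne, hac.2, had.2⟩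
  -- With all distances at most 2, a nonadjacent pair x, y has a common neighbour w, and the fourth
  -- vertex z is adjacent to something. So at least three of the six pairs are adjacent and the
  -- doubled sum is at most 2(3 + 6) = 18. If no pair is nonadjacent, it is 12.
  · exfalso
    push Not at hfar
    by_cases hcomp : ∃ x ∈ s, ∃ y ∈ s, x ≠ y ∧ ¬ H.twoSection.Adj x y
    · obtain ⟨x, hx, y, hy, hne, hxy⟩ := hcomp
      have hcommon : ∀ x ∈ s, ∀ y ∈ s, x ≠ y → ¬ H.twoSection.Adj x y →
          ∃ w ∈ s, H.twoSection.Adj x w ∧ H.twoSection.Adj y w := by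
        intro x hx y hy hne hxy
        have h := hfar x hx y hy
        rw [← not_lt, SimpleGraph.two_lt_edist_iff] at h
        simp only [hne, hxy, ne_eq, not_false_eq_true, true_and,
          ← Set.not_nonempty_iff_eq_empty, not_not] at h
        obtain ⟨w, hw⟩ := h
        rw [SimpleGraph.mem_commonNeighbors] at hw
        refine ⟨w, ?_, hw⟩
        obtain ⟨-, e, he, -, hwe⟩ := hw.1
        have := H.subset_vertexSet_of_mem_edgeSet' he hwe
        rwa [← hs] at this
      obtain ⟨w, hw, hxw, hyw⟩ := hcommon x hx y hy hne hxy
      have hsub : ({w, x, y} : Finset α) ⊆ s := by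
        intro t ht
        simp only [Finset.mem_insert, Finset.mem_singleton] at ht
        rcases ht with rfl | rfl | rfl <;> assumption
      have h3 : ({w, x, y} : Finset α).card = 3 := by
        rw [Finset.card_insert_of_notMem, Finset.card_pair hne]
        simpa using ⟨hxw.ne', hyw.ne'⟩
      have h1 : (s \ {w, x, y}).card = 1 := by
        rw [Finset.card_sdiff_of_subset hsub, hcard, h3]
      obtain ⟨z, hz⟩ := Finset.card_eq_one.mp h1
      have hs4 : s = {w, x, y, z} := by
        rw [← Finset.union_sdiff_of_subset hsub, hz]
        ext t; simp
      have hzs : z ∈ s \ {w, x, y} := by rw [hz]; simp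
      simp only [Finset.mem_sdiff, Finset.mem_insert, Finset.mem_singleton, not_or] at hzs
      obtain ⟨hz, hzw, hzx, hzy⟩ := hzs
      have hzadj : H.twoSection.Adj z w ∨ H.twoSection.Adj z x ∨ H.twoSection.Adj z y := by
        by_cases h : H.twoSection.Adj z x
        · exact Or.inr (Or.inl h)
        obtain ⟨t, ht, hzt, -⟩ := hcommon z hz x hx hzx h
        rw [hs4] at ht
        simp only [Finset.mem_insert, Finset.mem_singleton] at ht
        rcases ht with rfl | rfl | rfl | rfl
        · exact Or.inl hzt
        · exact Or.inr (Or.inl hzt)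
        · exact Or.inr (Or.inr hzt)
        · exact absurd rfl hzt.ne
      rw [two_mul_wiener_of_four (a := w) (b := x) (c := y) (d := z) (by rw [← hs, hs4]; simp)
        hxw.ne' hyw.ne' (Ne.symm hzw) hne (Ne.symm hzx) (Ne.symm hzy)] at hW
      have e1 := (SimpleGraph.edist_eq_one_iff_adj.mpr hxw.symm).le
      have e2 := (SimpleGraph.edist_eq_one_iff_adj.mpr hyw.symm).le
      have e3 := hfar w hw z hz
      have e4 := hfar x hx y hy
      have e5 := hfar x hx z hz
      have e6 := hfar y hy z hz
      rcases hzadj with h | h | h <;>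
        replace h := (SimpleGraph.edist_eq_one_iff_adj.mpr h.symm).le
      · have := hW.trans (mul_le_mul_right (add_le_add (add_le_add (add_le_add
          (add_le_add (add_le_add e1 e2) h) e4) e5) e6) 2)
        norm_num at this
      · have := hW.trans (mul_le_mul_right (add_le_add (add_le_add (add_le_add
          (add_le_add (add_le_add e1 e2) e3) e4) h) e6) 2)
        norm_num at this
      · have := hW.trans (mul_le_mul_right (add_le_add (add_le_add (add_le_add
          (add_le_add (add_le_add e1 e2) e3) e4) e5) h) 2)
        norm_num at this
    · push Not at hcomp
      rw [two_mul_wiener hs, Finset.sum_congr rfl (g := fun _ => 1)] at hW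
      · rw [Finset.sum_const, Finset.offDiag_card, hcard] at hW
        norm_num at hW
      · intro p hp
        obtain ⟨h1, h2, h3⟩ := Finset.mem_offDiag.mp hp
        exact SimpleGraph.edist_eq_one_iff_adj.mpr (hcomp _ h1 _ h2 h3)

end Four

/-! ### Orders below 5, and the vertex deletions in order 5 -/

section Order

variable {α : Type*} {H : Hypergraph α} [DecidableEq α] {s : Finset α} {v : α}

theorem coe_erase_eq_vertexSet_deleteVertex (hs : (s : Set α) = H.vertexSet) (v : α) :
    ((s.erase v : Finset α) : Set α) = (H.deleteVertex v).vertexSet := by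
  rw [Finset.coe_erase, hs]; rfl

/-- Every summand is at least 1, so a sum equal to the number of terms leaves no room for a term of
size 2. -/
theorem edist_eq_one_of_two_mul_wiener_eq (hs : (s : Set α) = H.vertexSet)
    (hW : 2 * H.wiener = s.offDiag.card) {x y : α} (hx : x ∈ s) (hy : y ∈ s) (hxy : x ≠ y) :
    H.twoSection.edist x y = 1 := by
  have hp : (x, y) ∈ s.offDiag := Finset.mem_offDiag.mpr ⟨hx, hy, hxy⟩
  have hpos : ∀ p ∈ s.offDiag, (1 : ℕ∞) ≤ H.twoSection.edist p.1 p.2 := fun p hp =>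
    Order.one_le_iff_pos.mpr (SimpleGraph.edist_pos_of_ne (Finset.mem_offDiag.mp hp).2.2)
  refine le_antisymm ?_ (hpos _ hp)
  by_contra hlt
  have h2 := Order.add_one_le_of_lt (not_le.mp hlt)
  rw [two_mul_wiener hs, ← Finset.add_sum_erase _ _ hp] at hW
  have h3 : ((s.offDiag.erase (x, y)).card : ℕ∞) ≤
      ∑ p ∈ s.offDiag.erase (x, y), H.twoSection.edist p.1 p.2 := by
    rw [Finset.card_eq_sum_ones, Nat.cast_sum]
    exact Finset.sum_le_sum fun p hp => by simpa using hpos p (Finset.mem_of_mem_erase hp)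
  have h4 := (add_le_add h2 h3).trans hW.le
  rw [Finset.card_erase_of_mem hp] at h4
  norm_cast at h4
  have := Finset.card_pos.mpr ⟨_, hp⟩
  omega

theorem two_mul_wiener_le (hs : (s : Set α) = H.vertexSet) (h : H.wiener ≠ ⊤) :
    2 * H.wiener ≤ ((s.offDiag.card * (s.card - 1) : ℕ) : ℕ∞) := by
  rw [two_mul_wiener hs]
  refine (Finset.sum_le_card_nsmul _ _ ((s.card - 1 : ℕ) : ℕ∞) fun p hp => ?_).trans ?_
  · obtain ⟨h1, h2, -⟩ := Finset.mem_offDiag.mp hp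
    have h3 := edist_ne_top_of_wiener_ne_top hs h h1 h2
    have h4 := edist_lt_card hs h1 h3
    obtain ⟨k, hk⟩ := ENat.ne_top_iff_exists.mp h3
    rw [← hk] at h4 ⊢
    norm_cast at h4 ⊢
    omega
  · simp

/-- Bounding each of the six distances by 2 gives only 12, exactly the lower bound 4 · 3 for order
4. Some pair is adjacent, which makes the inequality strict. -/
theorem two_mul_wiener_lt_of_card_eq_three (hs : (s : Set α) = H.vertexSet) (h : H.wiener ≠ ⊤)
    (hcard : s.card = 3) : 2 * H.wiener < 12 := by
  have hle : ∀ p ∈ s.offDiag, H.twoSection.edist p.1 p.2 ≤ 2 := by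
    intro p hp
    obtain ⟨h1, h2, -⟩ := Finset.mem_offDiag.mp hp
    have h3 := edist_ne_top_of_wiener_ne_top hs h h1 h2
    have h4 := edist_lt_card hs h1 h3
    obtain ⟨k, hk⟩ := ENat.ne_top_iff_exists.mp h3
    rw [← hk, hcard] at h4
    rw [← hk]
    norm_cast at h4 ⊢
    exact Nat.lt_succ_iff.mp h4
  have hoff : s.offDiag.card = 6 := by rw [Finset.offDiag_card, hcard]
  obtain ⟨p, hp, hp1⟩ : ∃ p ∈ s.offDiag, H.twoSection.edist p.1 p.2 ≤ 1 := by
    obtain ⟨p, hp⟩ : s.offDiag.Nonempty := by rw [← Finset.card_pos, hoff]; norm_num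
    obtain ⟨h1, h2, h3⟩ := Finset.mem_offDiag.mp hp
    by_cases hadj : H.twoSection.Adj p.1 p.2
    · exact ⟨p, hp, (SimpleGraph.edist_eq_one_iff_adj.mpr hadj).le⟩
    · have h4 := hle p hp
      rw [← not_lt, SimpleGraph.two_lt_edist_iff] at h4
      simp only [h3, hadj, ne_eq, not_false_eq_true, true_and,
        ← Set.not_nonempty_iff_eq_empty, not_not] at h4
      obtain ⟨w, hw⟩ := h4
      rw [SimpleGraph.mem_commonNeighbors] at hw
      refine ⟨(p.1, w), ?_, (SimpleGraph.edist_eq_one_iff_adj.mpr hw.1).le⟩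
      obtain ⟨hne, e, he, -, hwe⟩ := hw.1
      have := H.subset_vertexSet_of_mem_edgeSet' he hwe
      rw [← hs] at this
      exact Finset.mem_offDiag.mpr ⟨h1, this, hne⟩
  rw [two_mul_wiener hs, ← Finset.add_sum_erase _ _ hp]
  have h5 := Finset.sum_le_card_nsmul (s.offDiag.erase p)
    (fun p => H.twoSection.edist p.1 p.2) 2 fun q hq => hle q (Finset.mem_of_mem_erase hq)
  rw [Finset.card_erase_of_mem hp, hoff] at h5
  refine (add_le_add hp1 h5).trans_lt ?_
  norm_num

theorem IsSoltes.five_le_card (hs : (s : Set α) = H.vertexSet) (h : H.IsSoltes) : 5 ≤ s.card := by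
  by_contra hlt
  obtain ⟨v, hv⟩ := h.connected.1
  have hvs : v ∈ s := by rwa [← hs] at hv
  have h1 : s.card ≠ 1 := by
    have := h.order_ne_one
    rwa [← hs, Set.ncard_coe_finset] at this
  have h0 : 0 < s.card := Finset.card_pos.mpr ⟨v, hvs⟩
  have hW := h.wiener_deleteVertex v hv
  have hs' := coe_erase_eq_vertexSet_deleteVertex hs v
  have hfin : (H.deleteVertex v).wiener ≠ ⊤ := hW ▸ h.wiener_ne_top
  have hlow := card_offDiag_le_two_mul_wiener hs
  have hcard := Finset.card_erase_of_mem hvs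
  rw [← hW, Finset.offDiag_card] at hlow
  obtain h | h | h : s.card = 2 ∨ s.card = 3 ∨ s.card = 4 := by omega
  · have := hlow.trans (two_mul_wiener_le hs' hfin)
    rw [Finset.offDiag_card, hcard, h] at this
    norm_num at this
  · have := hlow.trans (two_mul_wiener_le hs' hfin)
    rw [Finset.offDiag_card, hcard, h] at this
    norm_num at this
  · have := hlow.trans_lt (two_mul_wiener_lt_of_card_eq_three hs' hfin (by rw [hcard, h]))
    rw [h] at this
    norm_num at this

/-- The bound 2W(H) ≥ 20 passes to H∖v, whose two-section is then an induced path, so 2W(H) is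
exactly 20. Two-section edges need not be hyperedges in general, but here a hyperedge with three
vertices would join two nonadjacent vertices of the path. -/
theorem IsSoltes.exists_path (hs : (s : Set α) = H.vertexSet) (h : H.IsSoltes)
    (hcard : s.card = 5) (hv : v ∈ s) :
    ∃ a b c d : α, s.erase v = {a, b, c, d} ∧ a ≠ b ∧ a ≠ c ∧ a ≠ d ∧ b ≠ c ∧ b ≠ d ∧ c ≠ d ∧
      (∀ e : Set α, (e ∈ H.edgeSet ∧ v ∉ e) ↔ e = {a, b} ∨ e = {b, c} ∨ e = {c, d}) ∧
      2 * H.wiener = s.offDiag.card := by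
  have hs' := coe_erase_eq_vertexSet_deleteVertex hs v
  have hW := h.wiener_deleteVertex v (by rwa [← hs])
  have hfin : (H.deleteVertex v).wiener ≠ ⊤ := hW ▸ h.wiener_ne_top
  have hoff : s.offDiag.card = 20 := by rw [Finset.offDiag_card, hcard]
  have hlow := card_offDiag_le_two_mul_wiener hs
  rw [← hW, hoff] at hlow
  obtain ⟨a, b, c, d, hset, hac, had, hbd, ab, bc, cd, nac, nad, nbd⟩ :=
    exists_induced_path hs' (by rw [Finset.card_erase_of_mem hv, hcard]) hfin hlow
  have hset' : ({a, b, c, d} : Set α) = (H.deleteVertex v).vertexSet := by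
    rw [← hs', hset]; simp
  refine ⟨a, b, c, d, hset, ab.ne, hac, had, bc.ne, hbd, cd.ne, ?_, ?_⟩
  · have hclass : ∀ e : Set α, (e ∈ H.edgeSet ∧ v ∉ e) →
        e = {a, b} ∨ e = {b, c} ∨ e = {c, d} := by
      intro e he
      have hsub : e ⊆ {a, b, c, d} :=
        hset' ▸ (H.deleteVertex v).subset_vertexSet_of_mem_edgeSet' he
      have h1 : a ∈ e → c ∉ e := fun h1 h2 => nac ⟨hac, e, he, h1, h2⟩
      have h2 : a ∈ e → d ∉ e := fun h1 h2 => nad ⟨had, e, he, h1, h2⟩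
      have h3 : b ∈ e → d ∉ e := fun h1 h2 => nbd ⟨hbd, e, he, h1, h2⟩
      obtain ⟨x, hx, y, hy, hxy⟩ := h.edge_nontrivial e he.1
      have hx' := hsub hx
      have hy' := hsub hy
      simp only [Set.mem_insert_iff, Set.mem_singleton_iff] at hx' hy'
      -- Two distinct members of `e` cannot be a nonadjacent pair of the path, hence are
      -- consecutive.
      have key : (a ∈ e ∧ b ∈ e) ∨ (b ∈ e ∧ c ∈ e) ∨ (c ∈ e ∧ d ∈ e) := by grind
      have hmem : ∀ t ∈ e, t = a ∨ t = b ∨ t = c ∨ t = d := fun t ht => by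
        simpa using hsub ht
      rcases key with h | h | h
      · left; ext t; simp only [Set.mem_insert_iff, Set.mem_singleton_iff]; grind
      · right; left; ext t; simp only [Set.mem_insert_iff, Set.mem_singleton_iff]; grind
      · right; right; ext t; simp only [Set.mem_insert_iff, Set.mem_singleton_iff]; grind
    have hpair : ∀ {e : Set α} {x y t : α}, e = {x, y} → t ∈ e → t = x ∨ t = y := by
      rintro e x y t rfl ht
      simpa using ht
    intro e
    refine ⟨hclass e, ?_⟩
    rintro (rfl | rfl | rfl)
    -- Conversely, the hyperedge witnessing a path adjacency is one of the three pairs, and only the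
    -- pair itself contains both ends.
    · obtain ⟨-, e, he, h1, h2⟩ := id ab
      rcases hclass e he with rfl | rfl | rfl
      · exact he
      · have := hpair rfl h1; have := ab.ne; grind
      · have := hpair rfl h1; grind
    · obtain ⟨-, e, he, h1, h2⟩ := id bc
      rcases hclass e he with rfl | rfl | rfl
      · have := hpair rfl h2; have := bc.ne; grind
      · exact he
      · have := hpair rfl h1; have := bc.ne; grind
    · obtain ⟨-, e, he, h1, h2⟩ := id cd
      rcases hclass e he with rfl | rfl | rfl
      · have := hpair rfl h2; grind
      · have := hpair rfl h2; have := cd.ne; grind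
      · exact he
  · rw [← hW, hoff, two_mul_wiener_of_path hset' hac had hbd ab bc cd nac nad nbd]
    norm_num

end Order

/-! ### Uniqueness in order 5 -/

section FiveCycle

variable {α : Type*} {H : Hypergraph α}

theorem exists_zmod_five {p : ZMod 5 → Prop} : (∃ i, p i) ↔ p 0 ∨ p 1 ∨ p 2 ∨ p 3 ∨ p 4 := by
  refine ⟨?_, by rintro (h | h | h | h | h) <;> exact ⟨_, h⟩⟩
  rintro ⟨i, h⟩
  fin_cases i
  exacts [Or.inl h, Or.inr (Or.inl h), Or.inr (Or.inr (Or.inl h)),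
    Or.inr (Or.inr (Or.inr (Or.inl h))), Or.inr (Or.inr (Or.inr (Or.inr h)))]

/-- Fix the path a, b, c, d left by deleting v. What remains is to find the hyperedges through v,
and the paths left by the other four deletions determine them. -/
theorem IsSoltes.exists_fiveCycle (h : H.IsSoltes) (hcard : H.vertexSet.ncard = 5) :
    ∃ x : ZMod 5 → α, Function.Injective x ∧ Set.range x = H.vertexSet ∧
      ∀ e, e ∈ H.edgeSet ↔ (∃ i, e = {x i, x (i + 1)}) ∨ e = H.vertexSet := by
  classical
  obtain ⟨s, hs⟩ : ∃ s : Finset α, (s : Set α) = H.vertexSet := ⟨h.finite.toFinset, by simp⟩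
  rw [← hs, Set.ncard_coe_finset] at hcard
  obtain ⟨v, hv⟩ := h.connected.1
  have hvs : v ∈ s := by rwa [← hs] at hv
  obtain ⟨a, b, c, d, hset, hab, hac, had, hbc, hbd, hcd, hE, hW⟩ := h.exists_path hs hcard hvs
  have hmem : ∀ t, t ∈ s ↔ t = v ∨ t = a ∨ t = b ∨ t = c ∨ t = d := by
    intro t
    rw [← Finset.insert_erase hvs, hset]
    simp
  have hnv : ∀ t, t = a ∨ t = b ∨ t = c ∨ t = d → v ≠ t := by
    rintro t ht rfl
    have : v ∈ s.erase v := by rw [hset]; simpa using ht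
    simp at this
  have hva : v ≠ a := hnv a (by simp)
  have hvb : v ≠ b := hnv b (by simp)
  have hvc : v ≠ c := hnv c (by simp)
  have hvd : v ≠ d := hnv d (by simp)
  have has : a ∈ s := (hmem a).mpr (by simp)
  have hbs : b ∈ s := (hmem b).mpr (by simp)
  have hcs : c ∈ s := (hmem c).mpr (by simp)
  have hds : d ∈ s := (hmem d).mpr (by simp)
  -- A hyperedge other than the full one misses some vertex u, hence survives in the path H∖u.
  have hpair : ∀ e ∈ H.edgeSet, e ≠ H.vertexSet → ∃ x y : α, e = {x, y} := by
    intro e he hne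
    have hsub := H.subset_vertexSet_of_mem_edgeSet' he
    obtain ⟨u, hu, hue⟩ := Set.exists_of_ssubset (hsub.ssubset_of_ne hne)
    rw [← hs] at hu
    obtain ⟨a', b', c', d', -, -, -, -, -, -, -, hE', -⟩ := h.exists_path hs hcard hu
    rcases (hE' e).mp ⟨he, hue⟩ with h | h | h <;> exact ⟨_, _, h⟩
  have hpair' : ∀ e ∈ H.edgeSet, ∀ u ∈ s, u ∉ e → ∀ x ∈ e, ∀ y ∈ e, x ≠ y → e = {x, y} := by
    intro e he u hu hue x hx y hy hxy
    obtain ⟨x', y', rfl⟩ := hpair e he (by rintro rfl; exact hue (hs ▸ hu))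
    simp only [Set.mem_insert_iff, Set.mem_singleton_iff] at hx hy
    rw [Set.pair_eq_pair_iff]
    grind
  -- A path on four vertices has no isolated vertex.
  have hcover : ∀ u ∈ s, ∀ t ∈ s, t ≠ u → ∃ e ∈ H.edgeSet, u ∉ e ∧ t ∈ e := by
    intro u hu t ht htu
    obtain ⟨a', b', c', d', hset', -, -, -, -, -, -, hE', -⟩ := h.exists_path hs hcard hu
    have : t ∈ s.erase u := Finset.mem_erase.mpr ⟨htu, ht⟩
    rw [hset'] at this
    simp only [Finset.mem_insert, Finset.mem_singleton] at this
    have h1 := (hE' {a', b'}).mpr (by simp)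
    have h2 := (hE' {c', d'}).mpr (by simp)
    rcases this with rfl | rfl | rfl | rfl
    exacts [⟨_, h1.1, h1.2, by simp⟩, ⟨_, h1.1, h1.2, by simp⟩, ⟨_, h2.1, h2.2, by simp⟩,
      ⟨_, h2.1, h2.2, by simp⟩]
  -- A path on four vertices has only three hyperedges, so no four distinct ones avoid u.
  have hfour : ∀ u ∈ s, ∀ e₁ e₂ e₃ e₄ : Set α, (e₁ ∈ H.edgeSet ∧ u ∉ e₁) →
      (e₂ ∈ H.edgeSet ∧ u ∉ e₂) → (e₃ ∈ H.edgeSet ∧ u ∉ e₃) → (e₄ ∈ H.edgeSet ∧ u ∉ e₄) →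
      e₁ ≠ e₂ → e₁ ≠ e₃ → e₁ ≠ e₄ → e₂ ≠ e₃ → e₂ ≠ e₄ → e₃ ≠ e₄ → False := by
    intro u hu e₁ e₂ e₃ e₄ h1 h2 h3 h4
    obtain ⟨a', b', c', d', -, -, -, -, -, -, -, hE', -⟩ := h.exists_path hs hcard hu
    rw [hE'] at h1 h2 h3 h4
    grind
  have eab : {a, b} ∈ H.edgeSet := ((hE _).mpr (by simp)).1
  have ebc : {b, c} ∈ H.edgeSet := ((hE _).mpr (by simp)).1
  have ecd : {c, d} ∈ H.edgeSet := ((hE _).mpr (by simp)).1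
  -- All distances in H are 1, so a and c share a hyperedge. If it were not full it would be {a, c},
  -- which avoids v and is not on the path.
  have hfull : H.vertexSet ∈ H.edgeSet := by
    have h1 := edist_eq_one_of_two_mul_wiener_eq hs hW has hcs hac
    rw [SimpleGraph.edist_eq_one_iff_adj] at h1
    obtain ⟨-, e, he, hae, hce⟩ := h1
    by_cases hev : e = H.vertexSet
    · exact hev ▸ he
    · obtain ⟨u, hu, hue⟩ := Set.exists_of_ssubset
        ((H.subset_vertexSet_of_mem_edgeSet' he).ssubset_of_ne hev)
      rw [← hs] at hu
      have h2 := hpair' e he u hu hue a hae c hce hac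
      have h3 := (hE e).mp ⟨he, by rw [h2]; simp [hva, hvc]⟩
      rw [h2] at h3
      simp only [Set.pair_eq_pair_iff] at h3
      grind
  -- After deleting b, the vertex a still lies in some hyperedge. The only hyperedge at a that
  -- avoids v is {a, b}, so this one contains v.
  have eva : {v, a} ∈ H.edgeSet := by
    obtain ⟨e, he, hbe, hae⟩ := hcover b hbs a has hab
    have hve : v ∈ e := by
      by_contra hve
      rcases (hE e).mp ⟨he, hve⟩ with rfl | rfl | rfl
      · simp at hbe
      · simp at hbe
      · simp [hac, had] at hae
    exact hpair' e he b hbs hbe v hve a hae hva ▸ he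
  have edv : {d, v} ∈ H.edgeSet := by
    obtain ⟨e, he, hce, hde⟩ := hcover c hcs d hds hcd.symm
    have hve : v ∈ e := by
      by_contra hve
      rcases (hE e).mp ⟨he, hve⟩ with rfl | rfl | rfl
      · simp [had.symm, hbd.symm] at hde
      · simp at hce
      · simp at hce
    exact hpair' e he c hcs hce d hde v hve hvd.symm ▸ he
  -- Otherwise {v, b}, {b, c}, {c, d}, {d, v} would be four hyperedges avoiding a.
  have nvb : {v, b} ∉ H.edgeSet := by
    intro evb
    apply hfour a has {v, b} {b, c} {c, d} {d, v} ⟨evb, by simp; grind⟩ ⟨ebc, by simp; grind⟩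
      ⟨ecd, by simp; grind⟩ ⟨edv, by simp; grind⟩ <;>
    · rw [ne_eq, Set.pair_eq_pair_iff]; grind
  have nvc : {v, c} ∉ H.edgeSet := by
    intro evc
    apply hfour d hds {v, c} {b, c} {a, b} {v, a} ⟨evc, by simp; grind⟩ ⟨ebc, by simp; grind⟩
      ⟨eab, by simp; grind⟩ ⟨eva, by simp; grind⟩ <;>
    · rw [ne_eq, Set.pair_eq_pair_iff]; grind
  obtain ⟨x, h0, h1, h2, h3, h4⟩ : ∃ x : ZMod 5 → α,
      x 0 = v ∧ x 1 = a ∧ x 2 = b ∧ x 3 = c ∧ x 4 = d :=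
    ⟨(![v, a, b, c, d] : Fin 5 → α), rfl, rfl, rfl, rfl, rfl⟩
  refine ⟨x, fun i j hij => ?_, ?_, fun e => ?_⟩
  · have hi := exists_zmod_five.mp ⟨i, rfl⟩
    have hj := exists_zmod_five.mp ⟨j, rfl⟩
    grind
  · rw [← hs]
    ext t
    rw [Finset.mem_coe, hmem, Set.mem_range, exists_zmod_five, h0, h1, h2, h3, h4]
    grind
  · rw [exists_zmod_five, show (0 + 1 : ZMod 5) = 1 from rfl, show (1 + 1 : ZMod 5) = 2 from rfl,
      show (2 + 1 : ZMod 5) = 3 from rfl, show (3 + 1 : ZMod 5) = 4 from rfl,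
      show (4 + 1 : ZMod 5) = 0 from rfl, h0, h1, h2, h3, h4]
    refine ⟨fun he => ?_, ?_⟩
    · by_cases hev : e = H.vertexSet
      · exact Or.inr hev
      left
      by_cases hve : v ∈ e
      · obtain ⟨u, hu, hue⟩ := Set.exists_of_ssubset
          ((H.subset_vertexSet_of_mem_edgeSet' he).ssubset_of_ne hev)
        rw [← hs] at hu
        obtain ⟨t, hte, htv⟩ := (h.edge_nontrivial e he).exists_ne v
        have heq := hpair' e he u hu hue v hve t hte htv.symm
        have hts : t ∈ (s : Set α) := hs ▸ H.subset_vertexSet_of_mem_edgeSet' he hte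
        rcases (hmem t).mp hts with rfl | rfl | rfl | rfl | rfl
        · exact absurd rfl htv
        · exact Or.inl heq
        · exact absurd (heq ▸ he) nvb
        · exact absurd (heq ▸ he) nvc
        · rw [Set.pair_comm] at heq
          exact Or.inr (Or.inr (Or.inr (Or.inr heq)))
      · rcases (hE e).mp ⟨he, hve⟩ with h | h | h <;> simp [h]
    · rintro ((rfl | rfl | rfl | rfl | rfl) | rfl) <;> assumption

/-- Replaces the isomorphism by a labelling of the vertices by ℤ/5, the form in which both
directions of the uniqueness statement are proved. -/
theorem isIsomorphic_fiveCyclePlus_iff : H.IsIsomorphic fiveCyclePlus ↔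
    ∃ x : ZMod 5 → α, Function.Injective x ∧ Set.range x = H.vertexSet ∧
      ∀ e, e ∈ H.edgeSet ↔ (∃ i, e = {x i, x (i + 1)}) ∨ e = H.vertexSet := by
  constructor
  · rintro ⟨f, hf⟩
    let g : ZMod 5 → H.vertexSet := fun i => f.symm ⟨i, trivial⟩
    have hfg : ∀ i, f (g i) = ⟨i, trivial⟩ := fun i => f.apply_symm_apply _
    have hgf : ∀ u, g (f u) = u := fun u => f.symm_apply_apply u
    refine ⟨fun i => g i, fun i j hij => ?_, ?_, fun e => ?_⟩
    · have := congrArg f (Subtype.ext hij : g i = g j)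
      rw [hfg, hfg] at this
      exact congrArg Subtype.val this
    · ext t
      refine ⟨?_, fun ht => ⟨f ⟨t, ht⟩, by simp [hgf]⟩⟩
      rintro ⟨i, rfl⟩
      exact (g i).2
    · by_cases hsub : e ⊆ H.vertexSet
      · obtain ⟨s, rfl⟩ : ∃ s : Set H.vertexSet, Subtype.val '' s = e :=
          ⟨Subtype.val ⁻¹' e, by simpa using hsub⟩
        rw [hf s]
        -- The transported set equals t exactly when the original is the image of t under the
        -- labelling; applied to cycle edges and to the full set.
        have himg : ∀ t : Set (ZMod 5), Subtype.val '' (f '' s) = t ↔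
            Subtype.val '' s = (fun i => (g i : α)) '' t := by
          intro t
          constructor
          · rintro rfl
            ext u
            constructor
            · rintro ⟨w, hw, rfl⟩
              exact ⟨(f w).1, ⟨f w, ⟨w, hw, rfl⟩, rfl⟩, congrArg Subtype.val (hgf w)⟩
            · rintro ⟨_, ⟨_, ⟨w, hw, rfl⟩, rfl⟩, rfl⟩
              exact ⟨w, hw, (congrArg Subtype.val (hgf w)).symm⟩
          · intro h
            have h2 : s = g '' t := by
              apply Subtype.val_injective.image_injective
              rw [h, Set.image_image]
            rw [h2, Set.image_image, Set.image_image]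
            simp [hfg]
        have huniv : (fun i => (g i : α)) '' Set.univ = H.vertexSet := by
          ext t
          refine ⟨?_, fun ht => ⟨f ⟨t, ht⟩, trivial, by simp [hgf]⟩⟩
          rintro ⟨i, -, rfl⟩
          exact (g i).2
        refine or_congr (exists_congr fun i => ?_) ?_
        · rw [himg, Set.image_pair]
        · rw [himg, huniv]
      · refine ⟨fun he => absurd (H.subset_vertexSet_of_mem_edgeSet' he) hsub, ?_⟩
        rintro (⟨i, rfl⟩ | rfl)
        · refine absurd ?_ hsub
          rintro t (rfl | rfl)
          exacts [(g i).2, (g (i + 1)).2]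
        · exact absurd le_rfl hsub
  · rintro ⟨x, hx, hr, hE⟩
    let g : ZMod 5 ≃ H.vertexSet := (Equiv.ofInjective x hx).trans (Equiv.setCongr hr)
    have hg : ∀ u, x (g.symm u) = u := fun u => congrArg Subtype.val (g.apply_symm_apply u)
    let f : H.vertexSet ≃ fiveCyclePlus.vertexSet :=
      ⟨fun u => ⟨g.symm u, trivial⟩, fun i => g i, fun u => g.apply_symm_apply u,
        fun i => Subtype.ext (g.symm_apply_apply i)⟩
    refine ⟨f, fun s => ?_⟩
    have himg : ∀ t : Set (ZMod 5), Subtype.val '' (f '' s) = t ↔ Subtype.val '' s = x '' t := by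
      have h1 : x '' (Subtype.val '' (f '' s)) = Subtype.val '' s := by
        rw [Set.image_image, Set.image_image]
        exact Set.image_congr fun u _ => hg u
      intro t
      rw [← h1, hx.image_injective.eq_iff]
    rw [hE]
    change _ ↔ (∃ i : ZMod 5, _ = ({i, i + 1} : Set (ZMod 5))) ∨ _ = Set.univ
    refine or_congr (exists_congr fun i => ?_) ?_
    · rw [himg, Set.image_pair]
    · rw [himg, Set.image_univ, hr]

end FiveCycle

/-! ### Criteria for being Šoltés when all vertices form a hyperedge -/

section Existence

variable {α : Type*} {H : Hypergraph α}

/-- If all vertices form a hyperedge, then all distances are `1`, and only the Wiener indices of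
the vertex-deleted hypergraphs matter. -/
theorem isSoltes_of_vertexSet_mem_edgeSet [DecidableEq α] {s : Finset α}
    (hs : (s : Set α) = H.vertexSet) (hcard : 1 < s.card)
    (hnontriv : ∀ e ∈ H.edgeSet, e.Nontrivial) (hfull : H.vertexSet ∈ H.edgeSet)
    (hW : ∀ v ∈ s, 2 * (H.deleteVertex v).wiener = s.offDiag.card) : H.IsSoltes := by
  have hadj : ∀ x ∈ s, ∀ y ∈ s, x ≠ y → H.twoSection.Adj x y := fun x hx y hy hxy =>
    ⟨hxy, _, hfull, hs ▸ hx, hs ▸ hy⟩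
  have hWH : 2 * H.wiener = s.offDiag.card := by
    rw [two_mul_wiener hs, Finset.card_eq_sum_ones, Nat.cast_sum]
    refine Finset.sum_congr rfl fun p hp => ?_
    obtain ⟨h1, h2, h3⟩ := Finset.mem_offDiag.mp hp
    simpa using hadj _ h1 _ h2 h3
  refine ⟨hs ▸ s.finite_toSet, hnontriv, ⟨?_, fun u hu v hv => ?_⟩, ?_, fun htop => ?_,
    fun v hv => ?_⟩
  · rw [← hs]
    exact_mod_cast Finset.card_pos.mp (by omega : 0 < s.card)
  · have : H.twoSection.Reachable u v := by
      by_cases h : u = v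
      · exact h ▸ SimpleGraph.Reachable.refl _
      · rw [← hs] at hu hv
        exact (hadj u hu v hv h).reachable
    obtain ⟨r, hr, -⟩ := exists_hasPath_of_reachable hu this
    exact ⟨r, hr⟩
  · rw [← hs, Set.ncard_coe_finset]
    omega
  · rw [htop, ENat.mul_top (by simp)] at hWH
    exact ENat.natCast_ne_top _ hWH.symm
  · rw [← hs] at hv
    have h := (hW v hv).trans hWH.symm
    exact le_antisymm ((ENat.mul_le_mul_left_iff (by simp) (by simp)).mp h.le)
      ((ENat.mul_le_mul_left_iff (by simp) (by simp)).mp h.ge)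

/-- Deleting `x i` leaves the induced path `x (i + 1)`, …, `x (i + 4)`, of doubled Wiener index 20 =
5 · 4. The adjacencies reduce to statements about ℤ/5 that are decided. -/
theorem isSoltes_of_fiveCycle (x : ZMod 5 → α) (hx : Function.Injective x)
    (hr : Set.range x = H.vertexSet)
    (hE : ∀ e, e ∈ H.edgeSet ↔ (∃ i, e = {x i, x (i + 1)}) ∨ e = H.vertexSet) :
    H.IsSoltes := by
  classical
  have hs : ((Finset.univ.image x : Finset α) : Set α) = H.vertexSet := by simpa using hr
  have hcard : (Finset.univ.image x).card = 5 := by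
    rw [Finset.card_image_of_injective _ hx]; rfl
  refine isSoltes_of_vertexSet_mem_edgeSet hs (by rw [hcard]; norm_num) ?_
    ((hE _).mpr (Or.inr rfl)) ?_
  · intro e he
    rcases (hE e).mp he with ⟨i, rfl⟩ | rfl
    · exact Set.nontrivial_pair (hx.ne ((by decide : ∀ i : ZMod 5, i ≠ i + 1) i))
    · rw [← hr]
      exact ⟨x 0, ⟨0, rfl⟩, x 1, ⟨1, rfl⟩, hx.ne (by decide)⟩
  · intro v hv
    obtain ⟨i, -, rfl⟩ := Finset.mem_image.mp hv
    have hadj : ∀ j k, (H.deleteVertex (x i)).twoSection.Adj (x j) (x k) ↔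
        j ≠ k ∧ ∃ l, i ∉ ({l, l + 1} : Finset (ZMod 5)) ∧ j ∈ ({l, l + 1} : Finset (ZMod 5)) ∧
          k ∈ ({l, l + 1} : Finset (ZMod 5)) := by
      intro j k
      refine and_congr hx.ne_iff ?_
      simp only [Finset.mem_insert, Finset.mem_singleton]
      constructor
      · rintro ⟨e, ⟨he, hie⟩, hj, hk⟩
        rcases (hE e).mp he with ⟨l, rfl⟩ | rfl
        · simp only [Set.mem_insert_iff, Set.mem_singleton_iff, hx.eq_iff] at hj hk hie
          exact ⟨l, hie, hj, hk⟩
        · exact absurd (hr ▸ ⟨i, rfl⟩) hie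
      · rintro ⟨l, hie, hj, hk⟩
        refine ⟨{x l, x (l + 1)}, ⟨(hE _).mpr (Or.inl ⟨l, rfl⟩), ?_⟩, ?_, ?_⟩ <;>
          simpa only [Set.mem_insert_iff, Set.mem_singleton_iff, hx.eq_iff]
    have hset : ({x (i + 1), x (i + 2), x (i + 3), x (i + 4)} : Set α) =
        (H.deleteVertex (x i)).vertexSet := by
      ext t
      simp only [deleteVertex, Set.mem_insert_iff, Set.mem_singleton_iff, Set.mem_sdiff, ← hr]
      constructor
      · rintro (rfl | rfl | rfl | rfl) <;>
          exact ⟨⟨_, rfl⟩, hx.ne (by clear hadj hv; revert i; decide)⟩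
      · rintro ⟨⟨j, rfl⟩, hj⟩
        rw [hx.eq_iff] at hj
        simp only [hx.eq_iff]
        clear hadj hv
        revert i j
        decide
    rw [two_mul_wiener_of_path hset, Finset.offDiag_card, hcard]
    · norm_num
    any_goals refine hx.ne ?_
    any_goals rw [hadj]
    all_goals
      clear hadj hset hv
      revert i
      decide

/-- If all distances are at most `3`, then the Wiener index is determined by the number of
non-adjacent pairs and the number of those without a common neighbour. -/
theorem two_mul_wiener_of_edist_le_three [DecidableEq α] {s : Finset α}
    (hs : (s : Set α) = H.vertexSet) (A : α → α → Prop) [DecidableRel A]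
    (hA : ∀ x y, H.twoSection.Adj x y ↔ A x y)
    (hdist : ∀ x ∈ s, ∀ y ∈ s, x ≠ y → A x y ∨
      ∃ w ∈ s, A x w ∧ (A w y ∨ ∃ z ∈ s, A w z ∧ A z y)) :
    2 * H.wiener = ((s.offDiag.card + (s.offDiag.filter fun p => ¬ A p.1 p.2).card +
      (s.offDiag.filter fun p => ¬ A p.1 p.2 ∧ ¬ ∃ w ∈ s, A p.1 w ∧ A w p.2).card : ℕ) : ℕ∞) := by
  rw [two_mul_wiener hs]
  have key : ∀ p ∈ s.offDiag, H.twoSection.edist p.1 p.2 =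
      ((1 + (if ¬ A p.1 p.2 then 1 else 0) +
        if ¬ A p.1 p.2 ∧ ¬ ∃ w ∈ s, A p.1 w ∧ A w p.2 then 1 else 0 : ℕ) : ℕ∞) := by
    rintro ⟨x, y⟩ hp
    obtain ⟨hx, hy, hxy⟩ := Finset.mem_offDiag.mp hp
    dsimp only at hx hy hxy ⊢
    by_cases h1 : A x y
    · simpa [h1] using (hA x y).mpr h1
    by_cases h2 : ∃ w ∈ s, A x w ∧ A w y
    · obtain ⟨w, hw, hxw, hwy⟩ := id h2
      have : H.twoSection.edist x y = 2 := SimpleGraph.edist_eq_two_iff.mpr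
        ⟨hxy, fun h => h1 ((hA x y).mp h), w, (hA x w).mpr hxw, ((hA w y).mpr hwy).symm⟩
      rw [this, if_pos h1, if_neg (fun h => h.2 h2)]
      norm_num
    · rw [if_pos h1, if_pos ⟨h1, h2⟩]
      obtain ⟨w, hw, hxw, hwz⟩ := (hdist x hx y hy hxy).resolve_left h1
      obtain ⟨z, hz, hwz, hzy⟩ := hwz.resolve_left fun h => h2 ⟨w, hw, hxw, h⟩
      apply le_antisymm
      · exact SimpleGraph.edist_le (.cons ((hA _ _).mpr hxw) (.cons ((hA _ _).mpr hwz)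
          (.cons ((hA _ _).mpr hzy) .nil)))
      · have : (2 : ℕ∞) < H.twoSection.edist x y := by
          rw [SimpleGraph.two_lt_edist_iff]
          refine ⟨hxy, fun h => h1 ((hA x y).mp h), ?_⟩
          ext t
          simp only [SimpleGraph.mem_commonNeighbors, Set.mem_empty_iff_false, iff_false, not_and]
          intro hxt hyt
          refine h2 ⟨t, ?_, (hA _ _).mp hxt, (hA _ _).mp hyt.symm⟩
          obtain ⟨-, e, he, -, hte⟩ := hxt
          have := H.subset_vertexSet_of_mem_edgeSet' he hte
          rwa [← hs] at this
        have h := Order.add_one_le_of_lt this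
        norm_num at h ⊢
        exact h
  rw [Finset.sum_congr rfl key, ← Nat.cast_sum, Finset.sum_add_distrib, Finset.sum_add_distrib,
    Finset.card_filter, Finset.card_filter, Finset.card_eq_sum_ones]

/-- A criterion for a hypergraph with vertex set `V` and hyperedge `V` to be Šoltés, in terms of
the adjacency relations `A v` of the vertex-deleted hypergraphs. -/
theorem isSoltes_of_adj {V : Type*} [Fintype V] [DecidableEq V] (H : Hypergraph V)
    (hV : H.vertexSet = Set.univ) (hcard : 1 < Fintype.card V)
    (hnontriv : ∀ e ∈ H.edgeSet, e.Nontrivial) (hfull : Set.univ ∈ H.edgeSet)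
    (A : V → V → V → Prop) [∀ v, DecidableRel (A v)]
    (hA : ∀ v x y, A v x y ↔ x ≠ y ∧ ∃ e ∈ H.edgeSet, v ∉ e ∧ x ∈ e ∧ y ∈ e)
    (hdist : ∀ v x y, x ≠ v → y ≠ v → x ≠ y → A v x y ∨
      ∃ w, A v x w ∧ (A v w y ∨ ∃ z, A v w z ∧ A v z y))
    (hcount : ∀ v, ((Finset.univ.erase v).offDiag.filter fun p => ¬ A v p.1 p.2).card +
      ((Finset.univ.erase v).offDiag.filter fun p => ¬ A v p.1 p.2 ∧
        ¬ ∃ w, A v p.1 w ∧ A v w p.2).card = 2 * (Fintype.card V - 1)) : H.IsSoltes := by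
  have hs : ((Finset.univ : Finset V) : Set V) = H.vertexSet := by simp [hV]
  refine isSoltes_of_vertexSet_mem_edgeSet hs (by simpa using hcard) hnontriv (hV ▸ hfull) ?_
  intro v _
  have hmem : ∀ x y, A v x y → x ∈ Finset.univ.erase v := by
    intro x y h
    obtain ⟨-, e, -, hv, hx, -⟩ := (hA v x y).mp h
    simp only [Finset.mem_erase, Finset.mem_univ, and_true]
    rintro rfl
    exact hv hx
  have hexists : ∀ x y, (∃ w ∈ Finset.univ.erase v, A v x w ∧ A v w y) ↔
      ∃ w, A v x w ∧ A v w y :=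
    fun x y => ⟨fun ⟨w, _, h⟩ => ⟨w, h⟩, fun ⟨w, h⟩ => ⟨w, hmem _ _ h.2, h⟩⟩
  rw [two_mul_wiener_of_edist_le_three (coe_erase_eq_vertexSet_deleteVertex hs v) (A v)]
  · simp only [hexists]
    -- With n the number of vertices, the identity needed is (n-1)(n-2) + 2(n-1) = n(n-1).
    rw [add_assoc, hcount v, Finset.offDiag_card, Finset.offDiag_card,
      Finset.card_erase_of_mem (Finset.mem_univ v), Finset.card_univ]
    obtain ⟨n, hn⟩ := Nat.exists_eq_add_of_lt hcard
    rw [hn]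
    congr 1
    simp only [← Nat.mul_sub_one]
    simp only [Nat.add_sub_cancel]
    zify
    simp
    ring
  · intro x y
    rw [hA]
    refine and_congr_right fun _ => exists_congr fun e => ?_
    exact ⟨fun ⟨⟨h1, h2⟩, h3⟩ => ⟨h1, h2, h3⟩, fun ⟨h1, h2, h3⟩ => ⟨⟨h1, h2⟩, h3⟩⟩
  · intro x hx y hy hxy
    rcases hdist v x y (Finset.ne_of_mem_erase hx) (Finset.ne_of_mem_erase hy) hxy with
      h | ⟨w, hxw, h | ⟨z, hwz, hzy⟩⟩
    · exact Or.inl h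
    · exact Or.inr ⟨w, hmem _ _ h, hxw, Or.inl h⟩
    · exact Or.inr ⟨w, hmem _ _ hwz, hxw, Or.inr ⟨z, hmem _ _ hzy, hwz, hzy⟩⟩

end Existence

/-! ### Orders 6 and 7 by computation -/

section Small

/-- The hypergraph on all of `V` with the given finite sets of vertices as hyperedges. -/
def ofFinsets {V : Type*} (E : Finset (Finset V)) : Hypergraph V where
  vertexSet := Set.univ
  edgeSet := {e | ∃ f ∈ E, e = f}
  subset_vertexSet_of_mem_edgeSet' := fun _ _ => Set.subset_univ _

/-- A Boolean adjacency on `Fin n` turns every condition into one that can be evaluated. -/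
theorem isSoltes_ofFinsets {n : ℕ} (hn : 1 < n) (E : Finset (Finset (Fin n)))
    (hnontriv : ∀ f ∈ E, 1 < f.card) (hfull : Finset.univ ∈ E)
    (A : Fin n → Fin n → Fin n → Bool)
    (hA : ∀ v x y, A v x y = true ↔ x ≠ y ∧ ∃ f ∈ E, v ∉ f ∧ x ∈ f ∧ y ∈ f)
    (hdist : ∀ v x y, x ≠ v → y ≠ v → x ≠ y → A v x y ∨
      ∃ w, A v x w ∧ (A v w y ∨ ∃ z, A v w z ∧ A v z y))
    (hcount : ∀ v, ((Finset.univ.erase v).offDiag.filter fun p => ¬ A v p.1 p.2).card +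
      ((Finset.univ.erase v).offDiag.filter fun p => ¬ A v p.1 p.2 ∧
        ¬ ∃ w, A v p.1 w ∧ A v w p.2).card = 2 * (n - 1)) : (ofFinsets E).IsSoltes := by
  refine isSoltes_of_adj _ rfl (by simpa using hn) ?_ ⟨_, hfull, by simp⟩
    (fun v x y => A v x y = true) ?_ hdist (by simpa using hcount)
  · rintro _ ⟨f, hf, rfl⟩
    exact Finset.one_lt_card_iff_nontrivial.mp (hnontriv f hf)
  · intro v x y
    rw [hA]
    refine and_congr_right fun _ => ?_
    constructor
    · rintro ⟨f, hf, h⟩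
      exact ⟨f, ⟨f, hf, rfl⟩, by simpa using h⟩
    · rintro ⟨_, ⟨f, hf, rfl⟩, h⟩
      exact ⟨f, hf, by simpa using h⟩

set_option maxRecDepth 10000 in
-- Distance 3 does occur here: deleting 0 leaves four nonadjacent pairs, of which {3, 5} is at
-- distance 3, for an excess of 5 = n-1.
theorem isSoltes_six : (ofFinsets ({{0, 3, 5}, {1, 2, 4}, {3, 4}, {2, 5}, {0, 4}, {1, 5},
    Finset.univ} : Finset (Finset (Fin 6)))).IsSoltes := by
  refine isSoltes_ofFinsets (by norm_num) _ (by decide) (by decide)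
    -- The proposition decided is found by unification with the right-hand side of the adjacency
    -- hypothesis.
    (fun v x y => decide _) (fun v x y => decide_eq_true_iff) ?_ ?_
  · decide +kernel
  · decide +kernel

set_option maxRecDepth 10000 in
-- Deleting 6 leaves the triangular prism, with triangles {0, 2, 4} and {1, 3, 5}: its diameter is 2
-- and it has 15 - 9 = 6 = n-1 nonadjacent pairs.
theorem isSoltes_seven : (ofFinsets ({{0, 3}, {1, 4}, {2, 5}, {0, 3, 6}, {1, 4, 6}, {2, 5, 6},
    {1, 3, 5}, {0, 2, 4}, Finset.univ} : Finset (Finset (Fin 7)))).IsSoltes := by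
  refine isSoltes_ofFinsets (by norm_num) _ (by decide) (by decide)
    (fun v x y => decide _) (fun v x y => decide_eq_true_iff) ?_ ?_
  · decide +kernel
  · decide +kernel

end Small

/-! ### Orders at least 8: a cyclic construction -/

section Cyclic

variable {R : Type*} [CommRing R] {u : R}

/-- The hypergraph on a commutative ring whose hyperedges are the pairs of elements that do not
differ by `± u` or `± 2 * u`, the translates of `{0, 3 * u, 5 * u}`, and the set of all
elements. -/
def cyclicTriples (u : R) : Hypergraph R where
  vertexSet := Set.univ
  edgeSet := {e | e = Set.univ ∨ (∃ v, e = {v, v + 3 * u, v + 5 * u}) ∨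
    ∃ x y, x ≠ y ∧ y ≠ x + u ∧ x ≠ y + u ∧ y ≠ x + 2 * u ∧ x ≠ y + 2 * u ∧ e = {x, y}}
  subset_vertexSet_of_mem_edgeSet' := fun _ _ => Set.subset_univ _

/-- Adjacency in `cyclicTriples u` after removing `v`, if `u, 2 * u, …, 7 * u` are nonzero. -/
def cyclicAdj (u v x y : R) : Prop :=
  x ≠ y ∧ x ≠ v ∧ y ≠ v ∧ y ≠ x + u ∧ x ≠ y + u ∧
    ¬ (x = v + 3 * u ∧ y = v + 5 * u) ∧ ¬ (y = v + 3 * u ∧ x = v + 5 * u)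

instance [DecidableEq R] (u v : R) : DecidableRel (cyclicAdj u v) :=
  fun _ _ => inferInstanceAs (Decidable (_ ∧ _))

theorem ofNat_mul_ne_zero (hu : ∀ k : ℕ, 0 < k → k < 8 → (k : R) * u ≠ 0) :
    u ≠ 0 ∧ 2 * u ≠ 0 ∧ 3 * u ≠ 0 ∧ 4 * u ≠ 0 ∧ 5 * u ≠ 0 ∧ 6 * u ≠ 0 ∧ 7 * u ≠ 0 :=
  ⟨by simpa using hu 1, by simpa using hu 2, by simpa using hu 3, by simpa using hu 4,
    by simpa using hu 5, by simpa using hu 6, by simpa using hu 7⟩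

theorem eq_add_of_eq_add {v x y : R} (h : x = v + 3 * u ∧ y = v + 5 * u) :
    y = x + 2 * u ∧ v = x - 3 * u := by
  rw [h.1, h.2]
  constructor <;> ring

/-- A triple has differences 3u, 5u and 2u. The first two kinds of pair are hyperedges already, so
only pairs x, x + 2u depend on triples, and each lies in just the one based at x - 3u. Keeping these
differences away from ±u and ±2u uses that small multiples of u are nonzero; for instance 5u = -2u
would mean 7u = 0. -/
theorem cyclicAdj_iff (hu : ∀ k : ℕ, 0 < k → k < 8 → (k : R) * u ≠ 0) (v x y : R) :
    cyclicAdj u v x y ↔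
    x ≠ y ∧ ∃ e ∈ (cyclicTriples u).edgeSet, v ∉ e ∧ x ∈ e ∧ y ∈ e := by
  obtain ⟨h1, h2, h3, h4, h5, h6, h7⟩ := ofNat_mul_ne_zero hu
  refine and_congr_right fun hxy => ?_
  constructor
  · rintro ⟨hxv, hyv, ha, hb, hc, hd⟩
    by_cases hy : y = x + 2 * u
    · refine ⟨{x - 3 * u, x - 3 * u + 3 * u, x - 3 * u + 5 * u},
        Or.inr (Or.inl ⟨x - 3 * u, rfl⟩), ?_, ?_, ?_⟩ <;>
        simp only [Set.mem_insert_iff, Set.mem_singleton_iff] <;> grind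
    by_cases hx : x = y + 2 * u
    · refine ⟨{y - 3 * u, y - 3 * u + 3 * u, y - 3 * u + 5 * u},
        Or.inr (Or.inl ⟨y - 3 * u, rfl⟩), ?_, ?_, ?_⟩ <;>
        simp only [Set.mem_insert_iff, Set.mem_singleton_iff] <;> grind
    · exact ⟨{x, y}, Or.inr (Or.inr ⟨x, y, hxy, ha, hb, hy, hx, rfl⟩),
        by simp [hxv.symm, hyv.symm], by simp, by simp⟩
  · rintro ⟨e, rfl | ⟨w, rfl⟩ | ⟨a, b, hab, ha, hb, hc, hd, rfl⟩, hv, hx, hy⟩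
    · exact absurd trivial hv
    · simp only [Set.mem_insert_iff, Set.mem_singleton_iff, not_or] at hv hx hy
      obtain ⟨hv0, hv3, hv5⟩ := hv
      rcases hx with rfl | rfl | rfl <;> rcases hy with rfl | rfl | rfl <;>
        first
        | exact absurd rfl hxy
        | refine ⟨?_, ?_, ?_, ?_, fun h => ?_, fun h => ?_⟩
          iterate 4 grind
          all_goals
            obtain ⟨e₁, e₂⟩ := eq_add_of_eq_add h
            clear h
            grind
    · simp only [Set.mem_insert_iff, Set.mem_singleton_iff, not_or] at hv hx hy
      rcases hx with rfl | rfl <;> rcases hy with rfl | rfl <;>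
        first
        | exact absurd rfl hxy
        | refine ⟨?_, ?_, ?_, ?_, fun h => ?_, fun h => ?_⟩
          iterate 4 grind
          all_goals
            obtain ⟨e₁, e₂⟩ := eq_add_of_eq_add h
            clear h
            grind

/-- The cardinality of R is zero in R, so it annihilates u and cannot be one of 1, …, 7. -/
theorem six_lt_card [Fintype R] (hu : ∀ k : ℕ, 0 < k → k < 8 → (k : R) * u ≠ 0) :
    6 < Fintype.card R := by
  by_contra h
  exact hu (Fintype.card R) Fintype.card_pos (by omega) (by rw [Nat.cast_card_eq_zero, zero_mul])

theorem exists_notMem_of_six {V : Type*} [Fintype V] (hV : 6 < Fintype.card V) (a b c d e f : V) :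
    ∃ w, w ≠ a ∧ w ≠ b ∧ w ≠ c ∧ w ≠ d ∧ w ≠ e ∧ w ≠ f := by
  classical
  have h : ({a, b, c, d, e, f} : Finset V).card < (Finset.univ : Finset V).card :=
    Finset.card_le_six.trans_lt hV
  obtain ⟨w, -, hw⟩ := Finset.exists_mem_notMem_of_card_lt_card h
  exact ⟨w, by simpa using hw⟩

/-- Each nonadjacent pair has a common neighbour, so no distance exceeds 2. For a consecutive pair
only six elements must be avoided; for v + 3u and v + 5u the element v + u works. -/
theorem exists_cyclicAdj_cyclicAdj [Fintype R]
    (hu : ∀ k : ℕ, 0 < k → k < 8 → (k : R) * u ≠ 0) {v x y : R} (hx : x ≠ v)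
    (hy : y ≠ v) (hxy : x ≠ y) :
    cyclicAdj u v x y ∨ ∃ w, cyclicAdj u v x w ∧ cyclicAdj u v w y := by
  obtain ⟨h1, h2, h3, h4, h5, h6, h7⟩ := ofNat_mul_ne_zero hu
  have hcard : 6 < Fintype.card R := six_lt_card hu
  have hsucc : ∀ x, x ≠ v → x + u ≠ v → ∃ w, cyclicAdj u v x w ∧ cyclicAdj u v w (x + u) := by
    intro x hx hy
    -- At most one of v + 3u, v + 5u can lie in {x, x + u}, so the exceptional nonadjacency forbids
    -- at most one candidate t. The others forbidden are v, x, x + u and the outer neighbours x - u,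
    -- x + 2u.
    obtain ⟨t, ht⟩ : ∃ t, ∀ w, (x = v + 3 * u ∨ x + u = v + 3 * u → w = v + 5 * u → w = t) ∧
        (x = v + 5 * u ∨ x + u = v + 5 * u → w = v + 3 * u → w = t) := by
      by_cases h : x = v + 3 * u ∨ x + u = v + 3 * u
      · exact ⟨v + 5 * u, fun w => ⟨fun _ h => h, by grind⟩⟩
      · exact ⟨v + 3 * u, fun w => ⟨fun h' => absurd h' h, fun _ h => h⟩⟩
    obtain ⟨w, w1, w2, w3, w4, w5, w6⟩ :=
      exists_notMem_of_six hcard v x (x + u) (x + 2 * u) (x - u) t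
    have := ht w
    refine ⟨w, ⟨?_, ?_, ?_, ?_, ?_, ?_, ?_⟩, ?_, ?_, ?_, ?_, ?_, ?_, ?_⟩ <;> grind
  have hsymm : ∀ {x y : R}, cyclicAdj u v x y → cyclicAdj u v y x := by
    rintro x y ⟨a, b, c, d, e, f, g⟩
    exact ⟨a.symm, c, b, e, d, g, f⟩
  have hspecial : ∃ w, cyclicAdj u v (v + 3 * u) w ∧ cyclicAdj u v w (v + 5 * u) := by
    refine ⟨v + u, ⟨?_, ?_, ?_, ?_, ?_, ?_, ?_⟩, ?_, ?_, ?_, ?_, ?_, ?_, ?_⟩ <;> grind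
  by_cases ha : y = x + u
  · subst ha
    exact Or.inr (hsucc x hx hy)
  by_cases hb : x = y + u
  · subst hb
    obtain ⟨w, hw, hw'⟩ := hsucc y hy hx
    exact Or.inr ⟨w, hsymm hw', hsymm hw⟩
  by_cases hc : x = v + 3 * u ∧ y = v + 5 * u
  · rw [hc.1, hc.2]
    exact Or.inr hspecial
  by_cases hd : y = v + 3 * u ∧ x = v + 5 * u
  · rw [hd.1, hd.2]
    obtain ⟨w, hw, hw'⟩ := hspecial
    exact Or.inr ⟨w, hsymm hw', hsymm hw⟩
  · exact Or.inl ⟨hxy, hx, hy, ha, hb, hc, hd⟩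

/-- The nonadjacent ordered pairs are enumerated by the n-1 elements other than v, once for each
orientation. -/
theorem card_filter_not_cyclicAdj [Fintype R] [DecidableEq R]
    (hu : ∀ k : ℕ, 0 < k → k < 8 → (k : R) * u ≠ 0) (v : R) :
    ((Finset.univ.erase v).offDiag.filter fun p => ¬ cyclicAdj u v p.1 p.2).card =
      2 * (Fintype.card R - 1) := by
  obtain ⟨h1, h2, h3, h4, h5, h6, h7⟩ := ofNat_mul_ne_zero hu
  -- The element w stands for the consecutive pair (w, w + u). For w = v - u this pair would contain
  -- v, and its slot is taken by the extra pair (v + 3u, v + 5u).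
  let g : R → R × R := fun w => if w = v - u then (v + 3 * u, v + 5 * u) else (w, w + u)
  have hg : ∀ w a b, g w = (a, b) ↔
      (w = v - u ∧ a = v + 3 * u ∧ b = v + 5 * u) ∨ (w ≠ v - u ∧ a = w ∧ b = w + u) := by
    intro w a b
    simp only [g]
    split_ifs with h <;> simp [h] <;> grind
  have hinj : Function.Injective g := by
    intro w w' h
    obtain ⟨a, b, hab⟩ : ∃ a b, g w' = (a, b) := ⟨_, _, rfl⟩
    rw [hab, hg] at h
    rw [hg] at hab
    grind
  have hswap : Function.Injective (fun w => (g w).swap) := Prod.swap_injective.comp hinj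
  have hcard : (Finset.univ.erase v).card = Fintype.card R - 1 := by
    rw [Finset.card_erase_of_mem (Finset.mem_univ v), Finset.card_univ]
  have hmem : ∀ a b, (a, b) ∈ (Finset.univ.erase v).image g ↔
      a ≠ v ∧ b ≠ v ∧ (b = a + u ∨ (a = v + 3 * u ∧ b = v + 5 * u)) := by
    intro a b
    simp only [Finset.mem_image, Finset.mem_erase, Finset.mem_univ, and_true, hg]
    constructor
    · rintro ⟨w, hw, h | h⟩ <;> grind
    · rintro ⟨ha, hb, h | h⟩
      · exact ⟨a, ha, by grind⟩
      · exact ⟨v - u, by simpa using h1, by grind⟩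
  have hmem' : ∀ a b, (a, b) ∈ (Finset.univ.erase v).image (fun w => (g w).swap) ↔
      a ≠ v ∧ b ≠ v ∧ (a = b + u ∨ (b = v + 3 * u ∧ a = v + 5 * u)) := by
    intro a b
    have : (a, b) ∈ (Finset.univ.erase v).image (fun w => (g w).swap) ↔
        (b, a) ∈ (Finset.univ.erase v).image g := by
      simp only [Finset.mem_image, ← Prod.swap_prod_mk (a := b) (b := a),
        Prod.swap_injective.eq_iff]
    rw [this, hmem]
    tauto
  have hunion : ((Finset.univ.erase v).offDiag.filter fun p => ¬ cyclicAdj u v p.1 p.2) =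
      (Finset.univ.erase v).image g ∪ (Finset.univ.erase v).image (fun w => (g w).swap) := by
    ext ⟨a, b⟩
    rw [Finset.mem_union, hmem, hmem', Finset.mem_filter, Finset.mem_offDiag]
    simp only [cyclicAdj, Finset.mem_erase, Finset.mem_univ, and_true]
    grind
  rw [hunion, Finset.card_union_of_disjoint, Finset.card_image_of_injective _ hinj,
    Finset.card_image_of_injective _ hswap, hcard, two_mul]
  -- A pair enumerated in both orientations would force 2u = 0 or 3u = 0.
  rw [Finset.disjoint_left]
  rintro ⟨a, b⟩ hab hab'
  rw [hmem] at hab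
  rw [hmem'] at hab'
  rcases hab.2.2 with e | ⟨e₁, e₂⟩ <;> rcases hab'.2.2 with f | ⟨f₁, f₂⟩
  · exact h2 (by linear_combination -e - f)
  · exact h3 (by linear_combination -e + f₁ - f₂)
  · exact h3 (by linear_combination -f + e₁ - e₂)
  · exact h2 (by linear_combination e₁ - f₂)

theorem isSoltes_cyclicTriples [Fintype R]
    (hu : ∀ k : ℕ, 0 < k → k < 8 → (k : R) * u ≠ 0) : (cyclicTriples u).IsSoltes := by
  obtain ⟨h1, h2, h3, h4, h5, h6, h7⟩ := ofNat_mul_ne_zero hu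
  classical
  have hcard : 6 < Fintype.card R := six_lt_card hu
  refine isSoltes_of_adj _ rfl (by omega) ?_ (Or.inl rfl) (cyclicAdj u)
    (cyclicAdj_iff hu) (fun v x y hx hy hxy => ?_) fun v => ?_
  · rintro e (rfl | ⟨v, rfl⟩ | ⟨x, y, hxy, -, -, -, -, rfl⟩)
    · exact ⟨0, trivial, u, trivial, h1.symm⟩
    · exact ⟨v, by simp, v + 3 * u, by simp, by simpa using h3⟩
    · exact Set.nontrivial_pair hxy
  · exact (exists_cyclicAdj_cyclicAdj hu hx hy hxy).imp_right
      fun ⟨w, h, h'⟩ => ⟨w, h, Or.inl h'⟩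
  · rw [card_filter_not_cyclicAdj hu, Nat.add_eq_left, Finset.card_eq_zero,
      Finset.filter_eq_empty_iff]
    rintro ⟨x, y⟩ hp ⟨h, h'⟩
    simp only [Finset.mem_offDiag, Finset.mem_erase, Finset.mem_univ, and_true] at hp
    exact (exists_cyclicAdj_cyclicAdj hu hp.1 hp.2.1 hp.2.2).elim h h'

theorem exists_isSoltes_zmod (n : ℕ) [NeZero n] (hn : 8 ≤ n) :
    ∃ H : Hypergraph (ZMod n), H.vertexSet = Set.univ ∧ H.IsSoltes := by
  refine ⟨cyclicTriples 1, rfl, isSoltes_cyclicTriples fun k h0 hk => ?_⟩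
  rw [mul_one, ne_eq, ZMod.natCast_eq_zero_iff]
  exact Nat.not_dvd_of_pos_of_lt h0 (by omega)

end Cyclic

end Hypergraph

theorem mainTheorem1 :
    (∀ (α : Type*) (H : Hypergraph α), H.IsSoltes → 5 ≤ H.vertexSet.ncard) ∧
    (∀ (α : Type*) (H : Hypergraph α),
      (H.IsSoltes ∧ H.vertexSet.ncard = 5) ↔ H.IsIsomorphic Hypergraph.fiveCyclePlus) ∧
    (∀ n : ℕ, 5 ≤ n →
      ∃ H : Hypergraph (Fin n), H.vertexSet = Set.univ ∧ H.IsSoltes) := by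
  refine ⟨fun α H h => ?_, fun α H => ?_, fun n hn => ?_⟩
  · classical
    have hs : (h.finite.toFinset : Set α) = H.vertexSet := by simp
    rw [← hs, Set.ncard_coe_finset]
    exact h.five_le_card hs
  · rw [Hypergraph.isIsomorphic_fiveCyclePlus_iff]
    refine ⟨fun h => h.1.exists_fiveCycle h.2, ?_⟩
    rintro ⟨x, hx, hr, hE⟩
    refine ⟨Hypergraph.isSoltes_of_fiveCycle x hx hr hE, ?_⟩
    rw [← hr, ← Set.image_univ, Set.ncard_image_of_injective _ hx, Set.ncard_univ, Nat.card_zmod]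
  · obtain rfl | rfl | rfl | hn : n = 5 ∨ n = 6 ∨ n = 7 ∨ 8 ≤ n := by omega
    · exact ⟨Hypergraph.fiveCyclePlus, rfl, Hypergraph.isSoltes_of_fiveCycle id
        Function.injective_id Set.range_id fun _ => Iff.rfl⟩
    · exact ⟨_, rfl, Hypergraph.isSoltes_six⟩
    · exact ⟨_, rfl, Hypergraph.isSoltes_seven⟩
    -- For a successor, `ZMod (m + 1)` is `Fin (m + 1)` by definition.
    · obtain ⟨m, rfl⟩ : ∃ m, n = m + 1 := ⟨n - 1, by omega⟩
      exact Hypergraph.exists_isSoltes_zmod (m + 1) hn
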